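/- Consider a leader $x_r(k+1)=Sx_r(k)$, $y_r(k)=Rx_r(k)$ with known $S\in\mathbb R^{r\times r}$, $R\in\mathbb R^{p\times r}$, and $N$ followers $$x_i(k+1)=\bar A_ix_i(k)+\bar B_iu_i(k)+\bar E_iw_i(k),\qquad y_i(k)=C_ix_i(k)+D_iu_i(k),\qquad i=1,\dots,N,$$ with state $x_i\in\mathbb R^{n_i}$ ($n_i\ge 1$), input $u_i\in\mathbb R^{m_i}$, disturbance $w_i\in\mathbb R^{q_i}$, known $C_i,D_i$ and unknown $\bar A_i,\bar B_i,\bar E_i$. On the time interval $\{0,\dots,\tau\}$ each follower has generated the data $U_{i-}=[u_i(0)\ \cdots\ u_i(\tau-1)]$, $W_{i-}=[w_i(0)\ \cdots\ w_i(\tau-1)]$, $X_i=[x_i(0)\ \cdots\ x_i(\tau)]$; put $X_{i-}=[x_i(0)\ \cdots\ x_i(\tau-1)]$ and $X_{i+}=[x_i(1)\ \cdots\ x_i(\tau)]$. Let $$\Sigma_{w,i}=\{(A_i,B_i,E_i)\mid X_{i+}=A_iX_{i-}+B_iU_{i-}+E_iW_{i-}\}$$ be the set of systems that explain the data of follower $i$;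 thus $(\bar A_i,\bar B_i,\bar E_i)\in\Sigma_{w,i}$. A square matrix is called stable if all its complex eigenvalues have modulus less than $1$. Let $\mathcal A=[a_{ij}]$ be the adjacency matrix, with nonnegative entries, of the communication graph between the followers: $a_{ij}\neq0$ if and only if there is an edge from $j$ to $i$. Let $d_i=\sum_ja_{ij}$, $\mathcal D=\mathrm{diag}(d_1,\dots,d_N)$, $L=\mathcal D-\mathcal A$, and $G=\mathrm{diag}(g_1,\dots,g_N)$, where $g_i\ge0$, and $g_i>0$ means that the leader shares its state with follower $i$. Assume: 1. all eigenvalues of $S$ are simple and lie on the unit circle; 2. the graph has no self-loops and contains a (directed) spanning tree, and $g_i>0$ for at least one node $i$ that is the root of a spanning tree. A protocol consists of matrices $F$ and $K_i,\Pi_i,\Gamma_i$ ($i=1,\dots,N$) and is given by $$v_i(k+1)=Sv_i(k)+(1+d_i+g_i)^{-1}F\Big(\sum_{j=1}^Na_{ij}(v_j(k)-v_i(k))+g_i(x_r(k)-v_i(k))\Big),$$ $$u_i(k)=K_i(x_i(k)-\Pi_iv_i(k))+\Gamma_iv_i(k).$$ It achieves output synchronization for given follower systems $(A_i,B_i,E_i)$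 if the interconnection of the leader, the protocol and the followers $x_i(k+1)=A_ix_i(k)+B_iu_i(k)$ (that is, operated with $w_i=0$) satisfies $y_i(k)-y_r(k)\to0$, $v_i(k)-x_r(k)\to0$ and $x_i(k)-\Pi_iv_i(k)\to0$ as $k\to\infty$, for all $i$ and all initial states. The data $(U_{i-},W_{i-},X_i)$ are informative for output synchronization if there is one protocol that achieves output synchronization for all choices of systems $(A_i,B_i,E_i)\in\Sigma_{w,i}$, $i=1,\dots,N$. **Theorem.** The data $(U_{i-},W_{i-},X_i)$ are informative for output synchronization if and only if, for $i=1,\dots,N$, the following two statements hold: (i) there exists a right inverse $X_{i-}^\dagger$ of $X_{i-}$ such that $X_{i+}X_{i-}^\dagger$ is stable and $W_{i-}X_{i-}^\dagger=0$; (ii) there exists a matrix $M_i$ such that $X_{i+}M_i-X_{i-}M_iS=0$, $W_{i-}M_i=0$ and $C_iX_{i-}M_i+D_iU_{i-}M_i=R$. In this case a protocol that achieves output synchronization for all systems explaining the data is obtained as follows: take any $F$ such that $S-\lambda F$ is stable for every eigenvalue $\lambda$ of $(I_N+\mathcal D+G)^{-1}(L+G)$ (such an $F$ exists), and, for any $X_{i-}^\dagger$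 as in (i) and any $M_i$ as in (ii), put $K_i=U_{i-}X_{i-}^\dagger$, $\Pi_i=X_{i-}M_i$ and $\Gamma_i=U_{i-}M_i$. -/

import Mathlib

open scoped Matrix

noncomputable section

namespace OutputSync

/-! ### Matrices -/

/-- A real matrix regarded as a complex one. -/
def toC {k l : ℕ} (A : Matrix (Fin k) (Fin l) ℝ) : Matrix (Fin k) (Fin l) ℂ :=
  A.map (fun x : ℝ => (x : ℂ))

/-- Schur stability: all eigenvalues lie in the open unit disc. -/
def SchurStable {k : ℕ} (A : Matrix (Fin k) (Fin k) ℂ) : Prop :=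
  ∀ z ∈ spectrum ℂ A, ‖z‖ < 1

/-- All (complex) eigenvalues of `S` are simple and lie on the unit circle. -/
def SimpleUnitCircleSpectrum {r : ℕ} (S : Matrix (Fin r) (Fin r) ℝ) : Prop :=
  ∀ z ∈ spectrum ℂ (toC S), ‖z‖ = 1 ∧ (toC S).charpoly.rootMultiplicity z = 1

/-! ### The communication graph

The graph between the `N` followers is given by its adjacency matrix `a` with nonnegative entries;
`a j i` is the weight of the edge from `i` to `j`. The vector `g` holds the leader's weights. -/

/-- There is an edge from `i` to `j`. -/
def Edge {N : ℕ} (a : Matrix (Fin N) (Fin N) ℝ) (i j : Fin N) : Prop := a j i ≠ 0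

/-- The graph has no self-loops. -/
def IsSimple {N : ℕ} (a : Matrix (Fin N) (Fin N) ℝ) : Prop := ∀ i, a i i = 0

/-- `T` is (the edge relation of) a spanning tree with the given root of the graph whose edge
relation is `E`. -/
structure IsSpanningTree {N : ℕ} (E T : Fin N → Fin N → Prop) (root : Fin N) : Prop where
  isSubgraph : ∀ i j, T i j → E i j
  root_inDegree : ∀ i, ¬ T i root
  inDegree : ∀ j, j ≠ root → ∃! i, T i j
  connects : ∀ j, Relation.ReflTransGen T root j

/-- The node `i` is a root node: it is the root of some spanning tree. -/
def IsRootNode {N : ℕ} (a : Matrix (Fin N) (Fin N) ℝ) (i : Fin N) : Prop :=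
  ∃ T : Fin N → Fin N → Prop, IsSpanningTree (Edge a) T i

/-- The followers' graph is simple and contains a spanning tree, and the leader shares its
information with at least one of the root nodes. -/
def GraphAssumption {N : ℕ} (a : Matrix (Fin N) (Fin N) ℝ) (g : Fin N → ℝ) : Prop :=
  IsSimple a ∧ (∃ i, IsRootNode a i) ∧ ∃ i, IsRootNode a i ∧ 0 < g i

/-- The node degree `d_i = ∑ j, a_ij`. -/
def degree {N : ℕ} (a : Matrix (Fin N) (Fin N) ℝ) (i : Fin N) : ℝ := ∑ j, a i j

/-- The Laplacian matrix. -/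
def laplacian {N : ℕ} (a : Matrix (Fin N) (Fin N) ℝ) : Matrix (Fin N) (Fin N) ℝ :=
  Matrix.diagonal (degree a) - a

/-- The matrix `(I + 𝒟 + G)⁻¹ (L + G)`. -/
def couplingMatrix {N : ℕ} (a : Matrix (Fin N) (Fin N) ℝ) (g : Fin N → ℝ) :
    Matrix (Fin N) (Fin N) ℝ :=
  (1 + Matrix.diagonal (degree a) + Matrix.diagonal g)⁻¹ * (laplacian a + Matrix.diagonal g)

/-- `S - z F` is stable for every eigenvalue `z` of `(I + 𝒟 + G)⁻¹ (L + G)`. -/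
def SimultaneouslyStabilizes {N r : ℕ} (a : Matrix (Fin N) (Fin N) ℝ) (g : Fin N → ℝ)
    (S F : Matrix (Fin r) (Fin r) ℝ) : Prop :=
  ∀ z ∈ spectrum ℂ (toC (couplingMatrix a g)), SchurStable (toC S - z • toC F)

/-! ### Follower systems and data -/

/-- A follower system `x(k+1) = A x(k) + B u(k) + E w(k)`. -/
structure FollowerSystem (n m q : ℕ) where
  A : Matrix (Fin n) (Fin n) ℝ
  B : Matrix (Fin n) (Fin m) ℝ
  E : Matrix (Fin n) (Fin q) ℝ

/-- Measured data of a follower; the columns are the samples of the input and of the disturbance at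
times `0, …, τ - 1` and of the state at times `0, …, τ`. -/
structure FollowerData (n m q τ : ℕ) where
  U : Matrix (Fin m) (Fin τ) ℝ
  W : Matrix (Fin q) (Fin τ) ℝ
  X : Matrix (Fin n) (Fin (τ + 1)) ℝ

/-- The states at times `0, …, τ - 1`. -/
def FollowerData.Xminus {n m q τ : ℕ} (d : FollowerData n m q τ) : Matrix (Fin n) (Fin τ) ℝ :=
  d.X.submatrix id Fin.castSucc

/-- The states at times `1, …, τ`. -/
def FollowerData.Xplus {n m q τ : ℕ} (d : FollowerData n m q τ) : Matrix (Fin n) (Fin τ) ℝ :=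
  d.X.submatrix id Fin.succ

/-- The set of all systems that explain the data. -/
def FollowerData.systems {n m q τ : ℕ} (d : FollowerData n m q τ) :
    Set (FollowerSystem n m q) :=
  {s | d.Xplus = s.A * d.Xminus + s.B * d.U + s.E * d.W}

/-- `Xd` is a right inverse of `X₋` such that `X₊ Xd` is stable and `W₋ Xd = 0`. -/
def FollowerData.IsStabilizingRightInverse {n m q τ : ℕ} (d : FollowerData n m q τ)
    (Xd : Matrix (Fin τ) (Fin n) ℝ) : Prop :=
  d.Xminus * Xd = 1 ∧ SchurStable (toC (d.Xplus * Xd)) ∧ d.W * Xd = 0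

/-- `M` satisfies the linear equations `X₊ M - X₋ M S = 0`, `W₋ M = 0`, `C X₋ M + D U₋ M = R`. -/
def FollowerData.SolvesLinearEquations {n m q τ r p : ℕ} (d : FollowerData n m q τ)
    (S : Matrix (Fin r) (Fin r) ℝ) (R : Matrix (Fin p) (Fin r) ℝ)
    (C : Matrix (Fin p) (Fin n) ℝ) (D : Matrix (Fin p) (Fin m) ℝ)
    (M : Matrix (Fin τ) (Fin r) ℝ) : Prop :=
  d.Xplus * M - d.Xminus * M * S = 0 ∧ d.W * M = 0 ∧ C * d.Xminus * M + D * d.U * M = R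

/-! ### Protocols and output synchronization -/

/-- The gains of a distributed protocol. -/
structure Protocol {N : ℕ} (n m : Fin N → ℕ) (r : ℕ) where
  F : Matrix (Fin r) (Fin r) ℝ
  K : ∀ i, Matrix (Fin (m i)) (Fin (n i)) ℝ
  Pi : ∀ i, Matrix (Fin (n i)) (Fin r) ℝ
  Gam : ∀ i, Matrix (Fin (m i)) (Fin r) ℝ

/-- The control input `u_i = K_i (x_i - Π_i v_i) + Γ_i v_i`. -/
def Protocol.input {N r : ℕ} {n m : Fin N → ℕ} (P : Protocol n m r) (i : Fin N)
    (x : Fin (n i) → ℝ) (v : Fin r → ℝ) : Fin (m i) → ℝ :=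
  P.K i *ᵥ (x - P.Pi i *ᵥ v) + P.Gam i *ᵥ v

/-- `(xr, v, x)` is a trajectory of the leader, the local controllers and the followers, when the
followers are the systems `sys`, interconnected by the protocol `P`, with disturbances `w`. -/
structure IsTrajectory {N r : ℕ} {n m q : Fin N → ℕ} (S : Matrix (Fin r) (Fin r) ℝ)
    (a : Matrix (Fin N) (Fin N) ℝ) (g : Fin N → ℝ)
    (sys : ∀ i, FollowerSystem (n i) (m i) (q i)) (P : Protocol n m r)
    (w : ∀ i, ℕ → Fin (q i) → ℝ)
    (xr : ℕ → Fin r → ℝ) (v : Fin N → ℕ → Fin r → ℝ) (x : ∀ i, ℕ → Fin (n i) → ℝ) : Prop where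
  leader : ∀ k, xr (k + 1) = S *ᵥ xr k
  controller : ∀ i k, v i (k + 1) = S *ᵥ v i k + (1 + degree a i + g i)⁻¹ •
    (P.F *ᵥ (∑ j, a i j • (v j k - v i k) + g i • (xr k - v i k)))
  follower : ∀ i k, x i (k + 1) =
    (sys i).A *ᵥ x i k + (sys i).B *ᵥ P.input i (x i k) (v i k) + (sys i).E *ᵥ w i k

/-- The protocol `P` achieves output synchronization for the leader and the followers `sys`: for all
initial states, in the absence of disturbances, `y_i - y_r → 0`, `v_i - x_r → 0` and
`x_i - Π_i v_i → 0`, where `y_r = R x_r` and `y_i = C_i x_i + D_i u_i`. -/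
def AchievesOutputSync {N r p : ℕ} {n m q : Fin N → ℕ} (S : Matrix (Fin r) (Fin r) ℝ)
    (R : Matrix (Fin p) (Fin r) ℝ) (C : ∀ i, Matrix (Fin p) (Fin (n i)) ℝ)
    (D : ∀ i, Matrix (Fin p) (Fin (m i)) ℝ) (a : Matrix (Fin N) (Fin N) ℝ) (g : Fin N → ℝ)
    (sys : ∀ i, FollowerSystem (n i) (m i) (q i)) (P : Protocol n m r) : Prop :=
  ∀ (xr : ℕ → Fin r → ℝ) (v : Fin N → ℕ → Fin r → ℝ) (x : ∀ i, ℕ → Fin (n i) → ℝ),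
    IsTrajectory S a g sys P (fun _ _ => 0) xr v x →
    ∀ i,
      Filter.Tendsto (fun k => C i *ᵥ x i k + D i *ᵥ P.input i (x i k) (v i k) - R *ᵥ xr k)
        Filter.atTop (nhds 0) ∧
      Filter.Tendsto (fun k => v i k - xr k) Filter.atTop (nhds 0) ∧
      Filter.Tendsto (fun k => x i k - P.Pi i *ᵥ v i k) Filter.atTop (nhds 0)

/-- The protocol `P` achieves output synchronization for all followers that explain the data. -/
def AchievesOutputSyncForData {N r p τ : ℕ} {n m q : Fin N → ℕ} (S : Matrix (Fin r) (Fin r) ℝ)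
    (R : Matrix (Fin p) (Fin r) ℝ) (C : ∀ i, Matrix (Fin p) (Fin (n i)) ℝ)
    (D : ∀ i, Matrix (Fin p) (Fin (m i)) ℝ) (a : Matrix (Fin N) (Fin N) ℝ) (g : Fin N → ℝ)
    (data : ∀ i, FollowerData (n i) (m i) (q i) τ) (P : Protocol n m r) : Prop :=
  ∀ sys : ∀ i, FollowerSystem (n i) (m i) (q i),
    (∀ i, sys i ∈ (data i).systems) → AchievesOutputSync S R C D a g sys P

/-- The data are informative for output synchronization. -/
def InformativeForOutputSync {N r p τ : ℕ} {n m q : Fin N → ℕ} (S : Matrix (Fin r) (Fin r) ℝ)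
    (R : Matrix (Fin p) (Fin r) ℝ) (C : ∀ i, Matrix (Fin p) (Fin (n i)) ℝ)
    (D : ∀ i, Matrix (Fin p) (Fin (m i)) ℝ) (a : Matrix (Fin N) (Fin N) ℝ) (g : Fin N → ℝ)
    (data : ∀ i, FollowerData (n i) (m i) (q i) τ) : Prop :=
  ∃ P : Protocol n m r, AchievesOutputSyncForData S R C D a g data P

end OutputSync

end

namespace OutputSync

open Filter Topology

/-! ### Linear difference equations over the complex numbers -/

/-! Write H for the coupling matrix. Informativity is reduced to two facts about every explaining
system: A + BK is stable, and the regulator equations AΠ + BΓ = ΠS, CΠ + DΓ = R hold.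

These facts suffice (`achievesOutputSync_of_regulator`). The errors v_i - x_r evolve under I ⊗ S - H
⊗ F, whose eigenvalues are among those of S - lF for eigenvalues l of H. They drive the stable
recursion for x_i - Π_i v_i. A maximum principle on the graph gives |1 - l| < 1, so F = S is
admissible. Multiplying the data equation by X† and M yields the two facts for all explaining
systems at once.

They are also necessary (`AchievesOutputSync.regulator`). With controllers started on the leader's
state, any regulator mismatch is a forcing term Z S^k v₀ that must decay, and S has no decaying
modes. Since the facts hold on a whole affine set of systems, the homogeneous solutions satisfy AΠ +
BΓ = 0 and, by a trace bound, A + BK = 0. Linear duality (`exists_data_representation`) turns these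
identities into M and X†. -/

theorem tendsto_pow_of_spectralRadius_lt_one {A : Type*} [NormedRing A] [NormedAlgebra ℂ A]
    [CompleteSpace A] {x : A} (hx : spectralRadius ℂ x < 1) :
    Tendsto (fun k => x ^ k) atTop (𝓝 0) := by
  obtain ⟨c, hc, hc1⟩ := ENNReal.lt_iff_exists_nnreal_btwn.mp hx
  have hc1' : c < 1 := by exact_mod_cast hc1
  -- Gelfand's formula: eventually ‖x ^ k‖ < c ^ k with c < 1.
  have hev := (spectrum.pow_nnnorm_pow_one_div_tendsto_nhds_spectralRadius x).eventually_lt_const hc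
  refine squeeze_zero_norm' ?_ (tendsto_pow_atTop_nhds_zero_of_lt_one c.coe_nonneg
    (by exact_mod_cast hc1'))
  filter_upwards [hev, eventually_gt_atTop 0] with k hk hk0
  have hk0' : (k : ℝ) ≠ 0 := by positivity
  have h := ENNReal.rpow_le_rpow hk.le (Nat.cast_nonneg (α := ℝ) k)
  rw [← ENNReal.rpow_mul, one_div, inv_mul_cancel₀ hk0', ENNReal.rpow_one,
    ENNReal.rpow_natCast] at h
  exact_mod_cast h

theorem tendsto_zero_of_eigenvalues {V : Type*} [NormedAddCommGroup V] [NormedSpace ℂ V]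
    [FiniteDimensional ℂ V] (T : Module.End ℂ V)
    (hT : ∀ (z : ℂ) (v : V), v ≠ 0 → T v = z • v → ‖z‖ < 1)
    (x : ℕ → V) (hx : ∀ k, x (k + 1) = T (x k)) : Tendsto x atTop (𝓝 0) := by
  rcases subsingleton_or_nontrivial V with hV | hV
  · exact tendsto_const_nhds.congr fun k => Subsingleton.elim _ _
  have : CompleteSpace V := FiniteDimensional.complete ℂ V
  let e := Module.End.toContinuousLinearMap (𝕜 := ℂ) V
  have hr : spectralRadius ℂ (e T) < 1 := by
    refine spectrum.spectralRadius_lt_of_forall_lt (r := 1) (e T) fun z hz => ?_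
    rw [AlgEquiv.spectrum_eq, ← Module.End.hasEigenvalue_iff_mem_spectrum] at hz
    obtain ⟨v, hv⟩ := hz.exists_hasEigenvector
    exact_mod_cast hT z v hv.2 hv.apply_eq_smul
  have hp : ∀ k, x k = (e T ^ k) (x 0) := by
    intro k
    induction k with
    | zero => simp
    | succ k ih => rw [hx, pow_succ', mul_apply_eq_comp, ← ih]; rfl
  have h := tendsto_pow_of_spectralRadius_lt_one hr
  have h2 := ((ContinuousLinearMap.apply ℂ V (x 0)).continuous.tendsto 0).comp h
  rw [map_zero] at h2
  exact h2.congr fun k => (hp k).symm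

/-- A cascade of two stable linear difference equations is stable. -/
theorem tendsto_zero_of_cascade {V W : Type*} [NormedAddCommGroup V] [NormedSpace ℂ V]
    [FiniteDimensional ℂ V] [NormedAddCommGroup W] [NormedSpace ℂ W] [FiniteDimensional ℂ W]
    (T : Module.End ℂ V) (Q : Module.End ℂ W) (L : V →ₗ[ℂ] W)
    (hT : ∀ (z : ℂ) (v : V), v ≠ 0 → T v = z • v → ‖z‖ < 1)
    (hQ : ∀ (z : ℂ) (w : W), w ≠ 0 → Q w = z • w → ‖z‖ < 1)
    (x : ℕ → V) (y : ℕ → W) (hx : ∀ k, x (k + 1) = T (x k))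
    (hy : ∀ k, y (k + 1) = Q (y k) + L (x k)) : Tendsto y atTop (𝓝 0) := by
  have h := tendsto_zero_of_eigenvalues
    ((T ∘ₗ LinearMap.fst ℂ V W).prod (Q ∘ₗ LinearMap.snd ℂ V W + L ∘ₗ LinearMap.fst ℂ V W)) ?_
    (fun k => (x k, y k)) fun k => by simp [hx, hy]
  · exact (continuous_snd.tendsto (0 : V × W)).comp h
  · rintro z ⟨v, w⟩ hvw h
    simp only [LinearMap.prod_apply, Function.prod_apply, LinearMap.comp_apply,
      LinearMap.fst_apply, LinearMap.snd_apply, LinearMap.add_apply, Prod.smul_mk,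
      Prod.mk.injEq] at h
    -- The cascade is block triangular: an eigenvector with zero first component is one of `Q`, and
    -- otherwise its first component is one of `T`.
    by_cases hv : v = 0
    · subst hv
      exact hQ z w (by simpa using hvw) (by simpa using h.2)
    · exact hT z v hv h.1

theorem norm_lt_one_of_tendsto {V : Type*} [NormedAddCommGroup V] [NormedSpace ℂ V]
    {z : ℂ} {v : V} (hv : v ≠ 0) (h : Tendsto (fun k => z ^ k • v) atTop (𝓝 0)) : ‖z‖ < 1 := by
  by_contra! hz
  have h2 := h.norm
  rw [norm_zero] at h2
  have := ge_of_tendsto' h2 (b := ‖v‖) fun k => by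
    rw [norm_smul, norm_pow]
    exact le_mul_of_one_le_left (norm_nonneg _) (one_le_pow₀ hz)
  exact hv (norm_le_zero_iff.mp this)

/-- If `H` commutes with `P` and `Q`, then an eigenvalue of `P - Q * H` is an eigenvalue of
`P - l • Q` for some eigenvalue `l` of `H`. -/
theorem exists_common_eigenvector {V : Type*} [AddCommGroup V] [Module ℂ V]
    [FiniteDimensional ℂ V] {P Q H : Module.End ℂ V} (hP : Commute H P) (hQ : Commute H Q)
    {z : ℂ} {v : V} (hv : v ≠ 0) (hz : (P - Q * H) v = z • v) :
    ∃ (l : ℂ) (w : V), w ≠ 0 ∧ H w = l • w ∧ (P - l • Q) w = z • w := by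
  -- `H` preserves this eigenspace, hence has an eigenvector in it, on which `Q * H` acts as `l •
  -- Q`.
  let W := (P - Q * H).eigenspace z
  have hc : Commute (P - Q * H) H := (hP.sub_right (hQ.mul_right (Commute.refl H))).symm
  have hm : Set.MapsTo H W W := Module.End.mapsTo_genEigenspace_of_comm hc z 1
  have : Nontrivial W := ⟨⟨⟨v, Module.End.mem_eigenspace_iff.mpr hz⟩, 0,
    fun h => hv (congrArg Subtype.val h)⟩⟩
  obtain ⟨l, hl⟩ := Module.End.exists_eigenvalue (H.restrict hm)
  obtain ⟨w, hw⟩ := hl.exists_hasEigenvector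
  have hw1 : H w = l • (w : V) := congrArg Subtype.val hw.apply_eq_smul
  refine ⟨l, w, fun h => hw.2 (Subtype.ext h), hw1, ?_⟩
  have hw2 := Module.End.mem_eigenspace_iff.mp w.2
  simp only [LinearMap.sub_apply, Module.End.mul_apply, hw1, map_smul, LinearMap.smul_apply]
    at hw2 ⊢
  exact hw2

/-! ### Eigenvalues of matrices -/

theorem mem_spectrum_iff_exists_mulVec {k : ℕ} {A : Matrix (Fin k) (Fin k) ℂ} {z : ℂ} :
    z ∈ spectrum ℂ A ↔ ∃ v, v ≠ 0 ∧ A *ᵥ v = z • v := by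
  rw [← Matrix.spectrum_toLin', ← Module.End.hasEigenvalue_iff_mem_spectrum]
  constructor
  · intro h
    obtain ⟨v, hv⟩ := h.exists_hasEigenvector
    exact ⟨v, hv.2, by simpa using hv.apply_eq_smul⟩
  · rintro ⟨v, hv, h⟩
    exact Module.End.hasEigenvalue_of_hasEigenvector (x := v)
      ⟨Module.End.mem_eigenspace_iff.mpr (by simpa using h), hv⟩

theorem SchurStable.norm_lt_one {k : ℕ} {A : Matrix (Fin k) (Fin k) ℂ} (hA : SchurStable A)
    {z : ℂ} {v : Fin k → ℂ} (hv : v ≠ 0) (h : A *ᵥ v = z • v) : ‖z‖ < 1 :=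
  hA z (mem_spectrum_iff_exists_mulVec.mpr ⟨v, hv, h⟩)

/-- The trace is a sum of at most `k` eigenvalues, each in the unit disc. The bound is uniform over
stable matrices, so it limits unbounded perturbations. -/
theorem SchurStable.norm_trace_le {k : ℕ} {A : Matrix (Fin k) (Fin k) ℂ} (hA : SchurStable A) :
    ‖A.trace‖ ≤ k := by
  rw [Matrix.trace_eq_sum_roots_charpoly]
  have h : ∀ s : Multiset ℂ, (∀ z ∈ s, ‖z‖ ≤ 1) → ‖s.sum‖ ≤ s.card := by
    intro s
    induction s using Multiset.induction with
    | empty => simp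
    | cons b s ih =>
      intro hs
      rw [Multiset.sum_cons, Multiset.card_cons]
      have h1 := hs b (Multiset.mem_cons_self b s)
      have h2 := ih fun z hz => hs z (Multiset.mem_cons_of_mem hz)
      push_cast
      linarith [norm_add_le b s.sum]
  refine (h _ fun z hz => ?_).trans ?_
  · exact (hA z (Matrix.mem_spectrum_iff_isRoot_charpoly.mpr
      (Polynomial.isRoot_of_mem_roots hz))).le
  · have := A.charpoly.card_roots'
    rw [Matrix.charpoly_natDegree_eq_dim, Fintype.card_fin] at this
    exact_mod_cast this

/-! ### Real matrices regarded as complex ones -/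

/-- A real vector regarded as a complex one. -/
def vecToC {k : ℕ} (v : Fin k → ℝ) : Fin k → ℂ := fun i => (v i : ℂ)

theorem toC_mulVec_vecToC {k l : ℕ} (A : Matrix (Fin k) (Fin l) ℝ) (v : Fin l → ℝ) :
    toC A *ᵥ vecToC v = vecToC (A *ᵥ v) := by
  ext i
  simp [toC, vecToC, Matrix.mulVec, dotProduct]

theorem toC_mul {k l m : ℕ} (A : Matrix (Fin k) (Fin l) ℝ) (B : Matrix (Fin l) (Fin m) ℝ) :
    toC (A * B) = toC A * toC B :=
  Matrix.map_mul (f := Complex.ofRealHom)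

theorem toC_pow {k : ℕ} (A : Matrix (Fin k) (Fin k) ℝ) (j : ℕ) : toC (A ^ j) = toC A ^ j := by
  induction j with
  | zero => ext i l; by_cases h : i = l <;> simp [toC, h]
  | succ j ih => rw [pow_succ, toC_mul, ih, pow_succ]

theorem tendsto_vecToC_iff {k : ℕ} {x : ℕ → Fin k → ℝ} :
    Tendsto (fun j => vecToC (x j)) atTop (𝓝 0) ↔ Tendsto x atTop (𝓝 0) := by
  simp only [tendsto_pi_nhds]
  refine forall_congr' fun i => ?_
  rw [Pi.zero_apply, Pi.zero_apply, ← Complex.ofReal_zero]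
  exact Filter.tendsto_ofReal_iff' (𝕜 := ℂ) (x := 0) (f := fun j => x j i)

theorem tendsto_mulVec_zero {k l : ℕ} {x : ℕ → Fin l → ℝ} (A : Matrix (Fin k) (Fin l) ℝ)
    (hx : Tendsto x atTop (𝓝 0)) : Tendsto (fun j => A *ᵥ x j) atTop (𝓝 0) := by
  have h : Continuous fun v : Fin l → ℝ => A *ᵥ v := by fun_prop
  have h2 := (h.tendsto 0).comp hx
  rwa [Matrix.mulVec_zero] at h2

theorem tendsto_mul_pow_apply {k l : ℕ} {Z : Matrix (Fin k) (Fin l) ℝ}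
    {S : Matrix (Fin l) (Fin l) ℝ}
    (h : ∀ v, Tendsto (fun j => Z *ᵥ (S ^ j *ᵥ v)) atTop (𝓝 0)) (i : Fin k) (c : Fin l) :
    Tendsto (fun j => (Z * S ^ j : Matrix (Fin k) (Fin l) ℝ) i c) atTop (𝓝 0) := by
  have h1 := tendsto_pi_nhds.mp (h (Pi.single c 1)) i
  refine h1.congr fun j => ?_
  rw [Matrix.mulVec_mulVec, Matrix.mulVec_single_one]
  rfl

/-- A real matrix whose powers tend to zero is stable. -/
theorem schurStable_of_tendsto {k : ℕ} {A : Matrix (Fin k) (Fin k) ℝ}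
    (h : ∀ v, Tendsto (fun j => A ^ j *ᵥ v) atTop (𝓝 0)) : SchurStable (toC A) := by
  intro z hz
  obtain ⟨v, hv, hz⟩ := mem_spectrum_iff_exists_mulVec.mp hz
  have hp : ∀ j, toC A ^ j *ᵥ v = z ^ j • v := by
    intro j
    induction j with
    | zero => simp
    | succ j ih => rw [pow_succ, ← Matrix.mulVec_mulVec, hz, Matrix.mulVec_smul, ih, smul_smul,
        pow_succ']
  refine norm_lt_one_of_tendsto hv (tendsto_pi_nhds.mpr fun i => ?_)
  -- `v` is complex while `h` concerns real vectors; the passage is through the entries of `A ^ j`.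
  have hs := tendsto_finsetSum Finset.univ fun c (_ : c ∈ Finset.univ) =>
    (Filter.Tendsto.ofReal (tendsto_mul_pow_apply (Z := 1) (S := A)
      (by simpa using h) i c)).mul_const (v c)
  simp only [Complex.ofReal_zero, zero_mul, Finset.sum_const_zero] at hs
  refine hs.congr fun j => ?_
  rw [← hp j, ← toC_pow, one_mul]
  rfl

/-- No nonzero linear functional of a nonvanishing mode tends to zero. -/
theorem eq_zero_of_tendsto_mulVec_pow {k r : ℕ} {S : Matrix (Fin r) (Fin r) ℝ}
    (hS : ∀ z ∈ spectrum ℂ (toC S), 1 ≤ ‖z‖) {Z : Matrix (Fin k) (Fin r) ℝ}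
    (h : ∀ v, Tendsto (fun j => Z *ᵥ (S ^ j *ᵥ v)) atTop (𝓝 0)) : Z = 0 := by
  let St := (toC S)ᵀ
  -- The functionals that decay along the dynamics form an invariant subspace. Were it nonzero, it
  -- would contain an eigenvector with eigenvalue inside the unit disc, and this is an eigenvalue of
  -- `S` too. The rows of `Z` lie in it.
  let W : Submodule ℂ (Fin r → ℂ) :=
    { carrier := {f | Tendsto (fun j => St ^ j *ᵥ f) atTop (𝓝 0)}
      zero_mem' := by simp
      add_mem' := fun {f f'} hf hf' => by simpa [Matrix.mulVec_add] using hf.add hf'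
      smul_mem' := fun c f hf => by simpa [Matrix.mulVec_smul] using hf.const_smul c }
  have hm : Set.MapsTo (Matrix.toLin' St) W W := by
    intro f hf
    have h1 := (tendsto_add_atTop_iff_nat 1).mpr hf
    refine h1.congr fun j => ?_
    rw [pow_succ, ← Matrix.mulVec_mulVec, Matrix.toLin'_apply]
  have hW : Subsingleton W := by
    by_contra hn
    rw [not_subsingleton_iff_nontrivial] at hn
    obtain ⟨l, hl⟩ := Module.End.exists_eigenvalue ((Matrix.toLin' St).restrict hm)
    obtain ⟨w, hw⟩ := hl.exists_hasEigenvector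
    have hw0 : (w : Fin r → ℂ) ≠ 0 := fun h => hw.2 (Subtype.ext h)
    have hw1 : St *ᵥ w = l • (w : Fin r → ℂ) := congrArg Subtype.val hw.apply_eq_smul
    have hp : ∀ j, St ^ j *ᵥ (w : Fin r → ℂ) = l ^ j • (w : Fin r → ℂ) := by
      intro j
      induction j with
      | zero => simp
      | succ j ih => rw [pow_succ, ← Matrix.mulVec_mulVec, hw1, Matrix.mulVec_smul, ih, smul_smul,
          pow_succ']
    have h1 := norm_lt_one_of_tendsto hw0 (z := l) ((show Tendsto _ _ _ from w.2).congr hp)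
    have h2 : l ∈ spectrum ℂ (toC S) := by
      rw [Matrix.mem_spectrum_iff_isRoot_charpoly, ← Matrix.charpoly_transpose,
        ← Matrix.mem_spectrum_iff_isRoot_charpoly]
      exact mem_spectrum_iff_exists_mulVec.mpr ⟨w, hw0, hw1⟩
    exact absurd h1 (hS l h2).not_gt
  ext i c
  have hi : vecToC (Z i) ∈ W := by
    refine tendsto_pi_nhds.mpr fun b => ?_
    have h1 := Filter.Tendsto.ofReal (tendsto_mul_pow_apply h i b)
    simp only [Complex.ofReal_zero] at h1
    refine h1.congr fun j => ?_
    rw [← Matrix.transpose_pow, Matrix.mulVec_transpose, ← toC_pow]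
    simp [Matrix.mul_apply, Matrix.vecMul, dotProduct, toC, vecToC]
  have h0 := congrArg Subtype.val (hW.elim ⟨_, hi⟩ 0)
  have h1 := congrFun h0 c
  simpa [vecToC] using h1

/-! ### Solvability of linear matrix equations -/

/-- `D * M = Y` is solvable if every row vector that annihilates `D` also annihilates `Y`. -/
theorem exists_mul_eq_of_vecMul {s t k : Type*} [Fintype s] [Fintype t]
    {D : Matrix s t ℝ} {Y : Matrix s k ℝ} (h : ∀ f, f ᵥ* D = 0 → f ᵥ* Y = 0) :
    ∃ M : Matrix t k ℝ, D * M = Y := by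
  classical
  have hc : ∀ c, ∃ x, D *ᵥ x = Y.col c := by
    intro c
    by_contra hn
    have hn' : Y.col c ∉ LinearMap.range D.mulVecLin := by
      rintro ⟨x, hx⟩
      exact hn ⟨x, hx⟩
    obtain ⟨φ, hφ, hle⟩ := Submodule.exists_le_ker_of_notMem hn'
    let f : s → ℝ := fun i => φ (Pi.single i 1)
    have hf : ∀ v, φ v = f ⬝ᵥ v := by
      intro v
      conv_lhs => rw [LinearMap.pi_apply_eq_sum_univ φ v]
      simp only [dotProduct, smul_eq_mul, f]
      refine Finset.sum_congr rfl fun i _ => ?_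
      rw [mul_comm]
      congr 2
      ext j
      simp [Pi.single_apply, eq_comm]
    have h0 : f ᵥ* D = 0 := by
      ext j
      have h1 : φ (D *ᵥ Pi.single j 1) = 0 := hle ⟨Pi.single j 1, rfl⟩
      rw [hf, Matrix.dotProduct_mulVec, dotProduct_single, mul_one] at h1
      exact h1
    exact hφ ((hf _).trans (congrFun (h f h0) c))
  choose x hx using hc
  exact ⟨Matrix.of fun i c => x c i, Matrix.ext fun i c => congrFun (hx c) i⟩

/-! ### The communication graph -/

section Graph

variable {N : ℕ} {a : Matrix (Fin N) (Fin N) ℝ} {g : Fin N → ℝ}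

theorem one_add_degree_add_pos (ha : ∀ i j, 0 ≤ a i j) (hg : ∀ i, 0 ≤ g i) (i : Fin N) :
    0 < 1 + degree a i + g i := by
  have h1 : 0 ≤ degree a i := Finset.sum_nonneg fun j _ => ha i j
  linarith [hg i]

theorem couplingMatrix_apply (ha : ∀ i j, 0 ≤ a i j) (hg : ∀ i, 0 ≤ g i) (i j : Fin N) :
    couplingMatrix a g i j =
      (1 + degree a i + g i)⁻¹ * (laplacian a + Matrix.diagonal g) i j := by
  have h : (1 + Matrix.diagonal (degree a) + Matrix.diagonal g)⁻¹ =
      Matrix.diagonal fun i => (1 + degree a i + g i)⁻¹ := by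
    refine Matrix.inv_eq_right_inv ?_
    rw [← Matrix.diagonal_one, Matrix.diagonal_add, Matrix.diagonal_add,
      Matrix.diagonal_mul_diagonal]
    congr 1
    ext i
    exact mul_inv_cancel₀ (one_add_degree_add_pos ha hg i).ne'
  rw [couplingMatrix, h, Matrix.diagonal_mul]

theorem sum_laplacian_smul {V : Type*} [AddCommGroup V] [Module ℝ V] (w : Fin N → V)
    (i : Fin N) : ∑ j, (laplacian a + Matrix.diagonal g) i j • w j =
      (degree a i + g i) • w i - ∑ j, a i j • w j := by
  simp only [laplacian, Matrix.add_apply, Matrix.sub_apply, Matrix.diagonal_apply, add_smul,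
    sub_smul, ite_smul, zero_smul, Finset.sum_add_distrib, Finset.sum_sub_distrib,
    Finset.sum_ite_eq, Finset.mem_univ, if_true]
  abel

/-- The eigenvalues of `(I + 𝒟 + G)⁻¹ (L + G)` lie in the open unit disc centred at `1`. -/
theorem norm_one_sub_lt_one_of_mem_spectrum (ha : ∀ i j, 0 ≤ a i j) (hg : ∀ i, 0 ≤ g i)
    (hgraph : GraphAssumption a g) {z : ℂ} (hz : z ∈ spectrum ℂ (toC (couplingMatrix a g))) :
    ‖1 - z‖ < 1 := by
  obtain ⟨v, hv, hz⟩ := mem_spectrum_iff_exists_mulVec.mp hz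
  by_contra! hμ
  -- Row i of (1 - H)v = (1 - z)v, cleared of denominators, where 1 - H = (I + 𝒟 + G)⁻¹(I + 𝒜).
  have hrow : ∀ i, ((1 + degree a i + g i : ℝ) : ℂ) * ((1 - z) * v i) =
      v i + ∑ j, a i j • v j := by
    intro i
    have h1 := congrFun hz i
    have hc : ((1 + degree a i + g i : ℝ) : ℂ) ≠ 0 :=
      Complex.ofReal_ne_zero.mpr (one_add_degree_add_pos ha hg i).ne'
    have h2 : (toC (couplingMatrix a g) *ᵥ v) i = ((1 + degree a i + g i : ℝ) : ℂ)⁻¹ *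
        ∑ j, (laplacian a + Matrix.diagonal g) i j • v j := by
      simp only [toC, Matrix.mulVec, dotProduct, Matrix.map_apply, couplingMatrix_apply ha hg,
        Finset.mul_sum, Complex.real_smul, Complex.ofReal_mul, Complex.ofReal_inv, mul_assoc]
    rw [h2, inv_mul_eq_iff_eq_mul₀ hc, sum_laplacian_smul, Pi.smul_apply, smul_eq_mul] at h1
    have h3 : (degree a i + g i) • v i = ((1 + degree a i + g i : ℝ) : ℂ) * v i - v i := by
      rw [Complex.real_smul]; push_cast; ring
    rw [h3] at h1
    linear_combination h1
  have hle : ∀ i, ∑ j, a i j * (‖v i‖ - ‖v j‖) + g i * ‖v i‖ ≤ 0 := by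
    intro i
    have hpos := one_add_degree_add_pos ha hg i
    have h1 : (1 + degree a i + g i) * ‖v i‖ ≤ ‖v i‖ + ∑ j, a i j * ‖v j‖ := by
      calc (1 + degree a i + g i) * ‖v i‖ ≤ (1 + degree a i + g i) * (‖1 - z‖ * ‖v i‖) := by
            gcongr
            exact le_mul_of_one_le_left (norm_nonneg _) hμ
        _ = ‖((1 + degree a i + g i : ℝ) : ℂ) * ((1 - z) * v i)‖ := by
            rw [norm_mul, norm_mul, Complex.norm_real, Real.norm_of_nonneg hpos.le]
        _ ≤ ‖v i‖ + ∑ j, a i j * ‖v j‖ := by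
            rw [hrow i]
            refine (norm_add_le _ _).trans (add_le_add_right ((norm_sum_le _ _).trans ?_) _)
            refine Finset.sum_le_sum fun j _ => ?_
            rw [norm_smul, Real.norm_of_nonneg (ha i j)]
    have h2 : ∑ j, a i j * (‖v i‖ - ‖v j‖) = degree a i * ‖v i‖ - ∑ j, a i j * ‖v j‖ := by
      simp only [mul_sub, Finset.sum_sub_distrib, degree, Finset.sum_mul]
    linarith
  obtain ⟨-, -, root, ⟨T, hT⟩, hroot⟩ := hgraph
  obtain ⟨top, -, htop⟩ := Finset.exists_max_image Finset.univ (fun i => ‖v i‖)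
    ⟨root, Finset.mem_univ root⟩
  -- Maximum principle: at a node of maximal modulus every term of `hle` is nonnegative, hence zero.
  -- Maximality thus passes back along edges to the root, where `g root > 0` forces the maximum to
  -- vanish.
  have hterm : ∀ i, ‖v i‖ = ‖v top‖ →
      (∀ j, a i j ≠ 0 → ‖v j‖ = ‖v top‖) ∧ g i * ‖v i‖ = 0 := by
    intro i hi
    have hnn : ∀ j ∈ Finset.univ, 0 ≤ a i j * (‖v i‖ - ‖v j‖) := fun j hj =>
      mul_nonneg (ha i j) (by linarith [htop j hj])
    have hnn' : 0 ≤ g i * ‖v i‖ := mul_nonneg (hg i) (norm_nonneg _)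
    have hs := Finset.sum_nonneg hnn
    have hs0 : ∑ j, a i j * (‖v i‖ - ‖v j‖) = 0 := by linarith [hle i]
    refine ⟨fun j hj => ?_, by linarith [hle i]⟩
    have := (Finset.sum_eq_zero_iff_of_nonneg hnn).mp hs0 j (Finset.mem_univ j)
    rcases mul_eq_zero.mp this with h | h
    · exact absurd h hj
    · linarith
  have hreach : ∀ i, Relation.ReflTransGen T i top → ‖v i‖ = ‖v top‖ := by
    intro i hi
    induction hi using Relation.ReflTransGen.head_induction_on with
    | refl => rfl
    | head h _ ih => exact (hterm _ ih).1 _ (hT.isSubgraph _ _ h)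
  have hr := hreach root (hT.connects top)
  have h0 : ‖v root‖ = 0 := by
    rcases mul_eq_zero.mp (hterm root hr).2 with h | h
    · exact absurd h hroot.ne'
    · exact h
  refine hv (funext fun i => norm_le_zero_iff.mp ?_)
  have := htop i (Finset.mem_univ i)
  linarith

/-- S - lS = (1 - l)S, and |1 - l| < 1 while S has no eigenvalue outside the closed unit disc. -/
theorem simultaneouslyStabilizes_self {r : ℕ} {S : Matrix (Fin r) (Fin r) ℝ}
    (hS : ∀ z ∈ spectrum ℂ (toC S), ‖z‖ ≤ 1) (ha : ∀ i j, 0 ≤ a i j) (hg : ∀ i, 0 ≤ g i)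
    (hgraph : GraphAssumption a g) : SimultaneouslyStabilizes a g S S := by
  intro l hl z hz
  have hl1 := norm_one_sub_lt_one_of_mem_spectrum ha hg hgraph hl
  obtain ⟨v, hv, hz⟩ := mem_spectrum_iff_exists_mulVec.mp hz
  rw [Matrix.sub_mulVec, Matrix.smul_mulVec, ← one_smul ℂ (toC S *ᵥ v), smul_smul, mul_one,
    ← sub_smul] at hz
  by_cases h0 : 1 - l = 0
  · rw [h0, zero_smul, eq_comm, smul_eq_zero] at hz
    simp [hz.resolve_right hv]
  · have h1 : toC S *ᵥ v = ((1 - l)⁻¹ * z) • v := by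
      rw [mul_smul, ← hz, smul_smul, inv_mul_cancel₀ h0, one_smul]
    have h2 := hS _ (mem_spectrum_iff_exists_mulVec.mpr ⟨v, hv, h1⟩)
    rw [norm_mul, norm_inv, inv_mul_le_iff₀ (norm_pos_iff.mpr h0), mul_one] at h2
    exact h2.trans_lt hl1

/-- The action of a matrix on families of vectors. -/
def familyMap {V : Type*} [AddCommGroup V] [Module ℂ V] (H : Matrix (Fin N) (Fin N) ℂ) :
    Module.End ℂ (Fin N → V) :=
  LinearMap.pi fun i => ∑ j, H i j • LinearMap.proj j

theorem familyMap_apply {V : Type*} [AddCommGroup V] [Module ℂ V]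
    (H : Matrix (Fin N) (Fin N) ℂ) (w : Fin N → V) (i : Fin N) :
    familyMap H w i = ∑ j, H i j • w j := by
  simp [familyMap, LinearMap.sum_apply]

/-- Stability of `I ⊗ S - H ⊗ F` follows from that of `S - l F` for all eigenvalues `l` of `H`. -/
theorem norm_lt_one_of_forall_spectrum {r : ℕ} {H : Matrix (Fin N) (Fin N) ℂ}
    {S F : Matrix (Fin r) (Fin r) ℂ} (hF : ∀ l ∈ spectrum ℂ H, SchurStable (S - l • F))
    (z : ℂ) (v : Fin N → Fin r → ℂ) (hv : v ≠ 0)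
    (hz : (S.mulVecLin.compLeft (Fin N) - F.mulVecLin.compLeft (Fin N) * familyMap H :
      Module.End ℂ (Fin N → Fin r → ℂ)) v = z • v) :
    ‖z‖ < 1 := by
  have hcomm : ∀ A : Matrix (Fin r) (Fin r) ℂ,
      Commute (familyMap H) (A.mulVecLin.compLeft (Fin N) : Module.End ℂ (Fin N → Fin r → ℂ)) := by
    intro A
    refine LinearMap.ext fun w => funext fun i => ?_
    simp [familyMap_apply]
  obtain ⟨l, w, hw, h1, h2⟩ := exists_common_eigenvector (hcomm S) (hcomm F) hv hz
  obtain ⟨i, hi⟩ := Function.ne_iff.mp hw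
  obtain ⟨c, hc⟩ := Function.ne_iff.mp hi
  have hl : l ∈ spectrum ℂ H := by
    -- The common eigenvector is sliced both ways: coordinate `c` across the nodes is an eigenvector
    -- of `H`, and the vector at node `i` is one of `S - l • F`.
    refine mem_spectrum_iff_exists_mulVec.mpr ⟨fun j => w j c, Function.ne_iff.mpr ⟨i, hc⟩, ?_⟩
    ext j
    have := congrFun (congrFun h1 j) c
    simpa [familyMap_apply, Matrix.mulVec, dotProduct] using this
  refine (hF l hl).norm_lt_one hi ?_
  have := congrFun h2 i
  simpa [Matrix.sub_mulVec, Matrix.smul_mulVec] using this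

end Graph

/-! ### Analysis of the closed loop -/

section ClosedLoop

variable {N r p : ℕ} {n m q : Fin N → ℕ} {S : Matrix (Fin r) (Fin r) ℝ}
  {R : Matrix (Fin p) (Fin r) ℝ} {C : ∀ i, Matrix (Fin p) (Fin (n i)) ℝ}
  {D : ∀ i, Matrix (Fin p) (Fin (m i)) ℝ} {a : Matrix (Fin N) (Fin N) ℝ} {g : Fin N → ℝ}
  {sys : ∀ i, FollowerSystem (n i) (m i) (q i)} {P : Protocol n m r}

theorem coupling_input_eq (ha : ∀ i j, 0 ≤ a i j) (hg : ∀ i, 0 ≤ g i)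
    (F : Matrix (Fin r) (Fin r) ℝ) (v : Fin N → Fin r → ℝ) (x : Fin r → ℝ) (i : Fin N) :
    (1 + degree a i + g i)⁻¹ • (F *ᵥ (∑ j, a i j • (v j - v i) + g i • (x - v i))) =
      -(F *ᵥ ∑ j, couplingMatrix a g i j • (v j - x)) := by
  have h1 : ∑ j, couplingMatrix a g i j • (v j - x) = (1 + degree a i + g i)⁻¹ •
      ∑ j, (laplacian a + Matrix.diagonal g) i j • (v j - x) := by
    simp only [couplingMatrix_apply ha hg, Finset.smul_sum, smul_smul]
  have h2 : ∑ j, a i j • (v j - v i) = ∑ j, a i j • (v j - x) - degree a i • (v i - x) := by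
    rw [degree, Finset.sum_smul, ← Finset.sum_sub_distrib]
    exact Finset.sum_congr rfl fun j _ => by rw [← smul_sub]; congr 1; abel
  rw [h1, sum_laplacian_smul, Matrix.mulVec_smul, ← smul_neg, ← Matrix.mulVec_neg, h2]
  congr 2
  module

/-- Serves the state update with (A, B) and the output with (C, D); the regulator expression appears
as the coefficient of `v`. -/
theorem feedback_output_eq {l k m r : ℕ} (C : Matrix (Fin l) (Fin k) ℝ)
    (D : Matrix (Fin l) (Fin m) ℝ) (K : Matrix (Fin m) (Fin k) ℝ) (Pi : Matrix (Fin k) (Fin r) ℝ)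
    (Gam : Matrix (Fin m) (Fin r) ℝ) (x : Fin k → ℝ) (v : Fin r → ℝ) :
    C *ᵥ x + D *ᵥ (K *ᵥ (x - Pi *ᵥ v) + Gam *ᵥ v) =
      (C + D * K) *ᵥ (x - Pi *ᵥ v) + (C * Pi + D * Gam) *ᵥ v := by
  simp only [Matrix.add_mulVec, Matrix.mulVec_add, ← Matrix.mulVec_mulVec, Matrix.mulVec_sub]
  abel

/-- The regulator equations together with stability of the local loops and of `S - l F` imply
output synchronization. -/
theorem achievesOutputSync_of_regulator (ha : ∀ i j, 0 ≤ a i j) (hg : ∀ i, 0 ≤ g i)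
    (hF : SimultaneouslyStabilizes a g S P.F)
    (hK : ∀ i, SchurStable (toC ((sys i).A + (sys i).B * P.K i)))
    (hPi : ∀ i, (sys i).A * P.Pi i + (sys i).B * P.Gam i = P.Pi i * S)
    (hR : ∀ i, C i * P.Pi i + D i * P.Gam i = R) : AchievesOutputSync S R C D a g sys P := by
  intro xr v x h i
  let ε : ℕ → Fin N → Fin r → ℂ := fun k j => vecToC (v j k - xr k)
  have hv : ∀ j k, v j (k + 1) = S *ᵥ v j k -
      P.F *ᵥ ∑ l, couplingMatrix a g j l • (v l k - xr k) := by
    intro j k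
    rw [h.controller, coupling_input_eq ha hg P.F (fun j => v j k), sub_eq_add_neg]
  have hsum : ∀ j k, familyMap (toC (couplingMatrix a g)) (ε k) j =
      vecToC (∑ l, couplingMatrix a g j l • (v l k - xr k)) := by
    intro j k
    ext c
    simp [familyMap_apply, ε, vecToC, toC]
  have hε : ∀ k, ε (k + 1) = ((toC S).mulVecLin.compLeft (Fin N) -
      (toC P.F).mulVecLin.compLeft (Fin N) * familyMap (toC (couplingMatrix a g)) :
        Module.End ℂ (Fin N → Fin r → ℂ)) (ε k) := by
    intro k
    ext j c
    have h1 : v j (k + 1) - xr (k + 1) = S *ᵥ (v j k - xr k) -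
        P.F *ᵥ ∑ l, couplingMatrix a g j l • (v l k - xr k) := by
      rw [hv, h.leader, Matrix.mulVec_sub]; abel
    simp only [LinearMap.sub_apply, Module.End.mul_apply, LinearMap.compLeft_apply, Pi.sub_apply,
      Function.comp_apply, Matrix.mulVecLin_apply, hsum, toC_mulVec_vecToC]
    simp only [ε, h1, toC_mulVec_vecToC]
    simp [vecToC]
  have hT := norm_lt_one_of_forall_spectrum hF
  have hε0 := tendsto_zero_of_eigenvalues _ hT ε hε
  have hvx : Tendsto (fun k => v i k - xr k) atTop (𝓝 0) :=
    tendsto_vecToC_iff.mp (tendsto_pi_nhds.mp hε0 i)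
  have hstep : ∀ k, x i (k + 1) - P.Pi i *ᵥ v i (k + 1) =
      ((sys i).A + (sys i).B * P.K i) *ᵥ (x i k - P.Pi i *ᵥ v i k) +
        (P.Pi i * P.F) *ᵥ ∑ l, couplingMatrix a g i l • (v l k - xr k) := by
    intro k
    rw [h.follower, hv, Protocol.input, feedback_output_eq, hPi]
    simp only [Matrix.mulVec_zero, Matrix.mulVec_sub, ← Matrix.mulVec_mulVec]
    abel
  have he : Tendsto (fun k => x i k - P.Pi i *ᵥ v i k) atTop (𝓝 0) := by
    refine tendsto_vecToC_iff.mp (tendsto_zero_of_cascade _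
      (toC ((sys i).A + (sys i).B * P.K i)).mulVecLin
      ((toC (P.Pi i * P.F)).mulVecLin ∘ₗ LinearMap.proj i ∘ₗ
        familyMap (toC (couplingMatrix a g))) hT
      (fun z w hw hz => (hK i).norm_lt_one hw hz) ε _ hε fun k => ?_)
    simp only [hstep, Matrix.mulVecLin_apply, LinearMap.comp_apply, LinearMap.proj_apply, hsum,
      toC_mulVec_vecToC]
    ext c
    simp [vecToC]
  refine ⟨?_, hvx, he⟩
  have hsum := (tendsto_mulVec_zero (C i + D i * P.K i) he).add (tendsto_mulVec_zero R hvx)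
  rw [add_zero] at hsum
  refine hsum.congr fun k => ?_
  rw [Protocol.input, feedback_output_eq, hR, Matrix.mulVec_sub R]
  abel

/-- There are trajectories along which the followers' controllers agree with the leader. -/
theorem exists_synchronized_trajectory (S : Matrix (Fin r) (Fin r) ℝ)
    (a : Matrix (Fin N) (Fin N) ℝ) (g : Fin N → ℝ)
    (sys : ∀ i, FollowerSystem (n i) (m i) (q i)) (P : Protocol n m r) (v₀ : Fin r → ℝ)
    (x₀ : ∀ i, Fin (n i) → ℝ) :
    ∃ x : ∀ i, ℕ → Fin (n i) → ℝ, IsTrajectory S a g sys P (fun _ _ => 0)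
      (fun k => S ^ k *ᵥ v₀) (fun _ k => S ^ k *ᵥ v₀) x ∧ ∀ i, x i 0 = x₀ i := by
  refine ⟨fun i k => Nat.rec (x₀ i) (fun k y => (sys i).A *ᵥ y +
    (sys i).B *ᵥ P.input i y (S ^ k *ᵥ v₀)) k, ⟨fun k => ?_, fun i k => ?_, fun i k => ?_⟩,
    fun i => rfl⟩
  · rw [pow_succ', Matrix.mulVec_mulVec]
  · simp [pow_succ', Matrix.mulVec_mulVec]
  · simp

/-- Output synchronization implies stability of the local loops and the regulator equations. -/
theorem AchievesOutputSync.regulator (hS : ∀ z ∈ spectrum ℂ (toC S), 1 ≤ ‖z‖)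
    (h : AchievesOutputSync S R C D a g sys P) (i : Fin N) :
    SchurStable (toC ((sys i).A + (sys i).B * P.K i)) ∧
      (sys i).A * P.Pi i + (sys i).B * P.Gam i = P.Pi i * S ∧
      C i * P.Pi i + D i * P.Gam i = R := by
  -- On a synchronized trajectory the coupling vanishes, and the regulator mismatches are the only
  -- forcing of e = x_i - Π_i v_i and of the output error.
  have key : ∀ (v₀ : Fin r → ℝ) (x₀ : ∀ i, Fin (n i) → ℝ), ∃ e : ℕ → Fin (n i) → ℝ,
      Tendsto e atTop (𝓝 0) ∧ e 0 = x₀ i - P.Pi i *ᵥ v₀ ∧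
      (∀ k, e (k + 1) = ((sys i).A + (sys i).B * P.K i) *ᵥ e k +
        ((sys i).A * P.Pi i + (sys i).B * P.Gam i - P.Pi i * S) *ᵥ (S ^ k *ᵥ v₀)) ∧
      Tendsto (fun k => (C i + D i * P.K i) *ᵥ e k +
        (C i * P.Pi i + D i * P.Gam i - R) *ᵥ (S ^ k *ᵥ v₀)) atTop (𝓝 0) := by
    intro v₀ x₀
    obtain ⟨x, hx, hx0⟩ := exists_synchronized_trajectory S a g sys P v₀ x₀
    obtain ⟨hy, -, he⟩ := h _ _ _ hx i
    refine ⟨_, he, by simp [hx0], fun k => ?_, hy.congr fun k => ?_⟩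
    · rw [hx.follower, Protocol.input, feedback_output_eq, pow_succ', Matrix.sub_mulVec,
        ← Matrix.mulVec_mulVec, Matrix.mulVec_zero, ← Matrix.mulVec_mulVec]
      abel
    · rw [Protocol.input, feedback_output_eq, Matrix.sub_mulVec]
      abel
  refine ⟨schurStable_of_tendsto fun w => ?_, sub_eq_zero.mp (eq_zero_of_tendsto_mulVec_pow hS
    fun v₀ => ?_), sub_eq_zero.mp (eq_zero_of_tendsto_mulVec_pow hS fun v₀ => ?_)⟩
  -- A leader at rest removes the forcing and leaves the free local loop started at `w`.
  · obtain ⟨e, he, he0, hes, -⟩ := key 0 (Function.update (fun _ => 0) i w)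
    refine he.congr fun k => ?_
    induction k with
    | zero => simp [he0]
    | succ k ih => rw [hes, ih, pow_succ', ← Matrix.mulVec_mulVec]; simp
  · obtain ⟨e, he, -, hes, -⟩ := key v₀ fun _ => 0
    have h1 := ((tendsto_add_atTop_iff_nat 1).mpr he).sub
      (tendsto_mulVec_zero ((sys i).A + (sys i).B * P.K i) he)
    rw [sub_zero] at h1
    refine h1.congr fun k => ?_
    rw [hes]
    abel
  · obtain ⟨e, he, -, -, hy⟩ := key v₀ fun _ => 0
    have h1 := hy.sub (tendsto_mulVec_zero (C i + D i * P.K i) he)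
    rw [sub_zero] at h1
    refine h1.congr fun k => ?_
    abel

end ClosedLoop

/-! ### Data-based conditions -/

/-- Duality: a row vector annihilating the stacked data X, U, W is copied into every row of (A, B,
E), and `hn` provides a row from which to read the result. The block for W is zero since E is absent
from the conclusion. -/
theorem exists_data_representation {n m q τ k : ℕ} (hn : 0 < n) {X : Matrix (Fin n) (Fin τ) ℝ}
    {U : Matrix (Fin m) (Fin τ) ℝ} {W : Matrix (Fin q) (Fin τ) ℝ} {Y : Matrix (Fin n) (Fin k) ℝ}
    {Z : Matrix (Fin m) (Fin k) ℝ}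
    (h : ∀ (A : Matrix (Fin n) (Fin n) ℝ) (B : Matrix (Fin n) (Fin m) ℝ)
      (E : Matrix (Fin n) (Fin q) ℝ), A * X + B * U + E * W = 0 → A * Y + B * Z = 0) :
    ∃ M : Matrix (Fin τ) (Fin k) ℝ, X * M = Y ∧ U * M = Z ∧ W * M = 0 := by
  obtain ⟨M, hM⟩ := exists_mul_eq_of_vecMul (D := Matrix.fromRows X (Matrix.fromRows U W))
    (Y := Matrix.fromRows Y (Matrix.fromRows Z 0)) fun f hf => by
      rw [Matrix.vecMul_fromRows, Matrix.vecMul_fromRows, ← add_assoc] at hf ⊢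
      have h1 := h (Matrix.of fun _ => f ∘ Sum.inl) (Matrix.of fun _ => (f ∘ Sum.inr) ∘ Sum.inl)
        (Matrix.of fun _ => (f ∘ Sum.inr) ∘ Sum.inr) (Matrix.ext fun _ c => congrFun hf c)
      rw [Matrix.vecMul_zero, add_zero]
      exact congrFun h1 ⟨0, hn⟩
  rw [Matrix.fromRows_mul, Matrix.fromRows_mul] at hM
  obtain ⟨h1, h2⟩ := Matrix.fromRows_inj hM
  exact ⟨M, h1, Matrix.fromRows_inj h2⟩

/-- If `A + t BᵀB` is stable for all `t`, then `B = 0`. -/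
theorem eq_zero_of_forall_schurStable {n : ℕ} {A B : Matrix (Fin n) (Fin n) ℝ}
    (h : ∀ t : ℝ, SchurStable (toC (A + t • (Bᵀ * B)))) : B = 0 := by
  have htr : ∀ t : ℝ, |A.trace + t * (Bᵀ * B).trace| ≤ n := by
    intro t
    have h1 := (h t).norm_trace_le
    have h2 : (toC (A + t • (Bᵀ * B))).trace = ((A.trace + t * (Bᵀ * B).trace : ℝ) : ℂ) := by
      rw [← smul_eq_mul t, ← Matrix.trace_smul, ← Matrix.trace_add]
      simp [Matrix.trace, toC]
    rwa [h2, Complex.norm_real, Real.norm_eq_abs] at h1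
  have h0 : (Bᵀ * B).trace = 0 := by
    by_contra hne
    -- This `t` would make the trace equal to n + 1, beyond the bound n.
    have h1 := htr ((n + 1 - A.trace) / (Bᵀ * B).trace)
    rw [div_mul_cancel₀ _ hne, add_sub_cancel, abs_of_pos (by positivity)] at h1
    linarith
  rw [← Matrix.conjTranspose_eq_transpose_of_trivial] at h0
  exact Matrix.trace_conjTranspose_mul_self_eq_zero_iff.mp h0

theorem FollowerData.exists_of_forall_regulator {n m q τ r p : ℕ} (hn : 0 < n)
    (d : FollowerData n m q τ) {s : FollowerSystem n m q} (hs : s ∈ d.systems)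
    {S : Matrix (Fin r) (Fin r) ℝ} {R : Matrix (Fin p) (Fin r) ℝ} {C : Matrix (Fin p) (Fin n) ℝ}
    {D : Matrix (Fin p) (Fin m) ℝ} {K : Matrix (Fin m) (Fin n) ℝ} {Pi : Matrix (Fin n) (Fin r) ℝ}
    {Gam : Matrix (Fin m) (Fin r) ℝ}
    (h : ∀ s ∈ d.systems, SchurStable (toC (s.A + s.B * K)) ∧ s.A * Pi + s.B * Gam = Pi * S ∧
      C * Pi + D * Gam = R) :
    (∃ Xd, d.IsStabilizingRightInverse Xd) ∧ ∃ M, d.SolvesLinearEquations S R C D M := by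
  have hs' : d.Xplus = s.A * d.Xminus + s.B * d.U + s.E * d.W := hs
  obtain ⟨hs1, hs2, hs3⟩ := h s hs
  have hadd : ∀ A B E, A * d.Xminus + B * d.U + E * d.W = 0 →
      FollowerSystem.mk (s.A + A) (s.B + B) (s.E + E) ∈ d.systems := by
    intro A B E h0
    change d.Xplus = _
    rw [hs', ← add_zero (s.A * d.Xminus + s.B * d.U + s.E * d.W), ← h0]
    simp only [Matrix.add_mul]
    abel
  constructor
  · obtain ⟨Xd, h1, h2, h3⟩ := exists_data_representation hn (X := d.Xminus) (U := d.U) (W := d.W)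
      (Y := 1) (Z := K) fun A B E h0 => by
        rw [Matrix.mul_one]
        refine eq_zero_of_forall_schurStable (A := s.A + s.B * K) fun t => ?_
        -- Left multiplication preserves homogeneous solutions. The factor (A + BK)ᵀ makes the
        -- closed loop change by t ZᵀZ with Z = A + BK, so that the trace argument applies.
        have h1 := (h _ (hadd (t • ((A + B * K)ᵀ * A)) (t • ((A + B * K)ᵀ * B))
          (t • ((A + B * K)ᵀ * E)) ?_)).1
        · convert h1 using 2
          simp only [Matrix.add_mul, Matrix.mul_add, Matrix.smul_mul, Matrix.mul_assoc, smul_add]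
          abel
        · simp only [Matrix.smul_mul, Matrix.mul_assoc]
          rw [← smul_add, ← smul_add, ← Matrix.mul_add, ← Matrix.mul_add, h0, Matrix.mul_zero,
            smul_zero]
    refine ⟨Xd, h1, ?_, h3⟩
    have h4 : d.Xplus * Xd = s.A + s.B * K := by
      rw [hs', Matrix.add_mul, Matrix.add_mul, Matrix.mul_assoc, Matrix.mul_assoc,
        Matrix.mul_assoc, h1, h2, h3, Matrix.mul_one, Matrix.mul_zero, add_zero]
    rwa [h4]
  · obtain ⟨M, h1, h2, h3⟩ := exists_data_representation hn (X := d.Xminus) (U := d.U) (W := d.W)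
      (Y := Pi) (Z := Gam) fun A B E h0 => by
        have h1 := (h _ (hadd A B E h0)).2.1
        rw [← hs2, Matrix.add_mul, Matrix.add_mul] at h1
        have h2 : s.A * Pi + A * Pi + (s.B * Gam + B * Gam) =
          s.A * Pi + s.B * Gam + (A * Pi + B * Gam) := by abel
        rw [h2] at h1
        exact add_eq_left.mp h1
    refine ⟨M, ?_, h3, ?_⟩
    · rw [hs', Matrix.add_mul, Matrix.add_mul, Matrix.mul_assoc, Matrix.mul_assoc,
        Matrix.mul_assoc, h1, h2, h3, hs2, Matrix.mul_zero, add_zero, sub_self]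
    · rw [Matrix.mul_assoc, Matrix.mul_assoc, h1, h2, hs3]

/-- Right multiplication of the data equation by `Xd` or `M` kills the disturbance term, so products
such as X₊X† = A + BK are the same for every explaining system. -/
theorem FollowerData.regulator_of_mem_systems {n m q τ r p : ℕ} {d : FollowerData n m q τ}
    {s : FollowerSystem n m q} (hs : s ∈ d.systems) {S : Matrix (Fin r) (Fin r) ℝ}
    {R : Matrix (Fin p) (Fin r) ℝ} {C : Matrix (Fin p) (Fin n) ℝ} {D : Matrix (Fin p) (Fin m) ℝ}
    {Xd : Matrix (Fin τ) (Fin n) ℝ} {M : Matrix (Fin τ) (Fin r) ℝ}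
    (hXd : d.IsStabilizingRightInverse Xd) (hM : d.SolvesLinearEquations S R C D M) :
    SchurStable (toC (s.A + s.B * (d.U * Xd))) ∧
      s.A * (d.Xminus * M) + s.B * (d.U * M) = d.Xminus * M * S ∧
      C * (d.Xminus * M) + D * (d.U * M) = R := by
  have hs' : d.Xplus = s.A * d.Xminus + s.B * d.U + s.E * d.W := hs
  obtain ⟨h1, h2, h3⟩ := hXd
  obtain ⟨h4, h5, h6⟩ := hM
  have hprod : ∀ {k : ℕ} (Y : Matrix (Fin τ) (Fin k) ℝ), d.W * Y = 0 →
      d.Xplus * Y = s.A * (d.Xminus * Y) + s.B * (d.U * Y) := by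
    intro k Y hY
    rw [hs', Matrix.add_mul, Matrix.add_mul, Matrix.mul_assoc, Matrix.mul_assoc,
      Matrix.mul_assoc, hY, Matrix.mul_zero, add_zero]
  refine ⟨?_, ?_, ?_⟩
  · rwa [hprod Xd h3, h1, Matrix.mul_one] at h2
  · rw [← hprod M h5, sub_eq_zero.mp h4]
  · rw [← Matrix.mul_assoc, ← Matrix.mul_assoc, h6]

end OutputSync

theorem theorem1 {N r p τ : ℕ} {n m q : Fin N → ℕ} (hn : ∀ i, 0 < n i)
    (S : Matrix (Fin r) (Fin r) ℝ) (R : Matrix (Fin p) (Fin r) ℝ)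
    (C : ∀ i, Matrix (Fin p) (Fin (n i)) ℝ) (D : ∀ i, Matrix (Fin p) (Fin (m i)) ℝ)
    (a : Matrix (Fin N) (Fin N) ℝ) (g : Fin N → ℝ)
    (ha : ∀ i j, 0 ≤ a i j) (hg : ∀ i, 0 ≤ g i)
    (hS : OutputSync.SimpleUnitCircleSpectrum S) (hgraph : OutputSync.GraphAssumption a g)
    (data : ∀ i, OutputSync.FollowerData (n i) (m i) (q i) τ)
    (trueSys : ∀ i, OutputSync.FollowerSystem (n i) (m i) (q i))
    (htrue : ∀ i, trueSys i ∈ (data i).systems) :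
    (OutputSync.InformativeForOutputSync S R C D a g data ↔
      ∀ i, (∃ Xd : Matrix (Fin τ) (Fin (n i)) ℝ, (data i).IsStabilizingRightInverse Xd) ∧
        ∃ M : Matrix (Fin τ) (Fin r) ℝ, (data i).SolvesLinearEquations S R (C i) (D i) M) ∧
    (∃ F : Matrix (Fin r) (Fin r) ℝ, OutputSync.SimultaneouslyStabilizes a g S F) ∧
    ∀ (F : Matrix (Fin r) (Fin r) ℝ) (Xd : ∀ i, Matrix (Fin τ) (Fin (n i)) ℝ)
      (M : Fin N → Matrix (Fin τ) (Fin r) ℝ),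
      OutputSync.SimultaneouslyStabilizes a g S F →
      (∀ i, (data i).IsStabilizingRightInverse (Xd i)) →
      (∀ i, (data i).SolvesLinearEquations S R (C i) (D i) (M i)) →
      OutputSync.AchievesOutputSyncForData S R C D a g data
        { F := F
          K := fun i => (data i).U * Xd i
          Pi := fun i => (data i).Xminus * M i
          Gam := fun i => (data i).U * M i } := by
  have hsuff : ∀ (F : Matrix (Fin r) (Fin r) ℝ) (Xd : ∀ i, Matrix (Fin τ) (Fin (n i)) ℝ)
      (M : Fin N → Matrix (Fin τ) (Fin r) ℝ),
      OutputSync.SimultaneouslyStabilizes a g S F →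
      (∀ i, (data i).IsStabilizingRightInverse (Xd i)) →
      (∀ i, (data i).SolvesLinearEquations S R (C i) (D i) (M i)) →
      OutputSync.AchievesOutputSyncForData S R C D a g data
        { F := F
          K := fun i => (data i).U * Xd i
          Pi := fun i => (data i).Xminus * M i
          Gam := fun i => (data i).U * M i } := by
    intro F Xd M hF hXd hM sys hsys
    have h := fun i =>
      OutputSync.FollowerData.regulator_of_mem_systems (hsys i) (hXd i) (hM i)
    exact OutputSync.achievesOutputSync_of_regulator ha hg hF (fun i => (h i).1)
      (fun i => (h i).2.1) fun i => (h i).2.2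
  have hF : ∃ F : Matrix (Fin r) (Fin r) ℝ, OutputSync.SimultaneouslyStabilizes a g S F :=
    ⟨S, OutputSync.simultaneouslyStabilizes_self (fun z hz => (hS z hz).1.le) ha hg hgraph⟩
  refine ⟨⟨?_, fun h => ?_⟩, hF, hsuff⟩
  · rintro ⟨P, hP⟩ i
    refine (data i).exists_of_forall_regulator (hn i) (htrue i) (K := P.K i) (Pi := P.Pi i)
      (Gam := P.Gam i) fun s hs => ?_
    -- Only follower `i` is varied; the true systems fill the other places.
    have hsync := hP (Function.update trueSys i s) fun j => by
      rcases eq_or_ne j i with rfl | hj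
      · rwa [Function.update_self]
      · rw [Function.update_of_ne hj]
        exact htrue j
    simpa using hsync.regulator (fun z hz => (hS z hz).1.ge) i
  · choose Xd hXd using fun i => (h i).1
    choose M hM using fun i => (h i).2
    obtain ⟨F, hF⟩ := hF
    exact ⟨_, hsuff F Xd M hF hXd hM⟩
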